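/- All digraphs are finite, without loops and without parallel arcs (opposite arcs are allowed); a digraph is acyclic if it contains no directed cycle, and the chromatic number $\chi(D)$ of a digraph $D$ is the chromatic number of its underlying undirected graph. For a class $\mathcal D$ of digraphs, $\chi(\mathcal D)$ is the smallest $k$ such that $\chi(D)\le k$ for all $D\in\mathcal D$, or $+\infty$ if no such $k$ exists. An oriented cycle is an orientation of an undirected cycle of length at least $2$ (in length $2$: two opposite arcs, or two parallel arcs). The blocks of an oriented cycle that is not a directed cycle are its maximal directed subpaths; a directed cycle counts as one block. A subdivision of an oriented cycle is obtained by replacing each arc $uv$ by a directed path of length at least $1$ from $u$ to $v$, these paths being internally disjoint. For a set $\mathcal C$ of oriented cycles, $\mathrm{SForb}(\mathcal C)$ is the class of digraphs that contain no subdivision of an element of $\mathcal C$ as a subdigraph, and $\mathrm{SForb}(C)=\mathrm{SForb}(\{C\})$. **Theorem.** (1) For all positive integers $b$ and $c$ there is an acyclic digraph $D$ with $\chi(D)\ge c$ in which every oriented cycle has more than $b$ blocks. (2) For every oriented cycle $C$, $\chi(\mathrm{SForb}(C))=+\infty$. (3) For every finite family $\mathcal C$ of oriented cycles, $\chi(\mathrm{SForb}(\mathcal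 C))=+\infty$. -/

import Mathlib

/-- A finite digraph without loops (two opposite arcs between the same two vertices are allowed,
parallel arcs are not). -/
structure FinDigraph where
  /-- the vertex set -/
  V : Type
  /-- the vertex set is finite -/
  finite : Finite V
  /-- the arcs: `graph.Adj u v` says that there is an arc from `u` to `v` -/
  graph : Digraph V
  /-- there are no loops -/
  loopless : ∀ v, ¬ graph.Adj v v

namespace FinDigraph

/-- The chromatic number of a digraph: the chromatic number of its underlying undirected graph. -/
noncomputable def chromaticNumber (D : FinDigraph) : ℕ∞ :=
  D.graph.toSimpleGraphInclusive.chromaticNumber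

/-- A digraph is acyclic if no nonempty directed walk returns to its starting vertex. -/
def Acyclic (D : FinDigraph) : Prop :=
  ∀ v, ¬ Relation.TransGen D.graph.Adj v v

end FinDigraph

/-- The chromatic number of a class of digraphs: the least `k` that bounds the chromatic number of
all its members, `⊤` if there is no finite one (and `0` for the empty class). -/
noncomputable def classChromaticNumber (𝒟 : Set FinDigraph) : ℕ∞ :=
  sInf {k : ℕ∞ | ∀ D ∈ 𝒟, D.chromaticNumber ≤ k}

/-- An oriented cycle, i.e. an orientation of a cycle, together with a starting vertex and a
direction to run through it. Its vertices are the residues modulo `length`, and its arcs are indexed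
by the same residues: the `i`-th arc joins the vertices `i` and `i + 1`, and it goes from `i` to
`i + 1` if `fwd i` is true and from `i + 1` to `i` otherwise.
The two cycles of length `2` (two opposite arcs, or two parallel arcs) are included. -/
structure OrientedCycle where
  /-- the number of vertices, which is also the number of arcs -/
  length : ℕ
  /-- there are at least two vertices -/
  two_le : 2 ≤ length
  /-- is the `i`-th arc a forward arc? -/
  fwd : ZMod length → Bool

namespace OrientedCycle

/-- The tail of the `i`-th arc. -/
def tail (C : OrientedCycle) (i : ZMod C.length) : ZMod C.length :=
  if C.fwd i then i else i + 1

/-- The head of the `i`-th arc. -/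
def head (C : OrientedCycle) (i : ZMod C.length) : ZMod C.length :=
  if C.fwd i then i + 1 else i

/-- An oriented cycle is directed if all its arcs have the same direction. -/
def IsDirected (C : OrientedCycle) : Prop :=
  ∀ i j, C.fwd i = C.fwd j

/-- The path formed by the `l` consecutive arcs `i, i + 1, …, i + l - 1` is a block of the
(non-directed) oriented cycle `C`: it is a directed path, and it is maximal, which means that
neither the arc before it nor the arc after it has the same direction. -/
def IsBlock (C : OrientedCycle) (i : ZMod C.length) (l : ℕ) : Prop :=
  1 ≤ l ∧ l < C.length ∧ (∀ t : ℕ, t < l → C.fwd (i + (t : ZMod C.length)) = C.fwd i) ∧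
    C.fwd (i - 1) ≠ C.fwd i ∧ C.fwd (i + (l : ZMod C.length)) ≠ C.fwd i

open Classical in
/-- The number of blocks of an oriented cycle; a directed cycle is regarded as a single block. -/
noncomputable def numBlocks (C : OrientedCycle) : ℕ :=
  if C.IsDirected then 1 else {p : ZMod C.length × ℕ | C.IsBlock p.1 p.2}.ncard

/-- `f` embeds the oriented cycle `C` as a subdigraph of `D`: distinct vertices go to distinct
vertices and distinct arcs go to distinct arcs of `D`. (The requirement on arcs is automatic if
the length is at least `3`; it excludes a pair of parallel arcs, which `D` does not have.) -/
def IsCopyIn (C : OrientedCycle) (D : FinDigraph) (f : ZMod C.length → D.V) : Prop :=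
  Function.Injective f ∧ (∀ i, D.graph.Adj (f (C.tail i)) (f (C.head i))) ∧
    Function.Injective fun i => (f (C.tail i), f (C.head i))

/-- `C'` is a subdivision of `C`: running through `C'` from a suitable vertex, the `i`-th arc of `C`
is replaced by the nonempty directed path formed by the arcs `p i, p i + 1, …, p (i + 1) - 1`
of `C'`, which all have the direction of the `i`-th arc of `C`; one turn around `C` corresponds to
one turn around `C'`. -/
def IsSubdivision (C' C : OrientedCycle) : Prop :=
  ∃ p : ℕ → ℕ, StrictMono p ∧ (∀ i, p (i + C.length) = p i + C'.length) ∧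
    ∀ i j : ℕ, p i ≤ j → j < p (i + 1) →
      C'.fwd (j : ZMod C'.length) = C.fwd (i : ZMod C.length)

end OrientedCycle

/-- The class of digraphs that contain, as a subdigraph, no subdivision of any element of `𝒞`. -/
def SForb (𝒞 : Set OrientedCycle) : Set FinDigraph :=
  {D | ∀ C ∈ 𝒞, ∀ C' : OrientedCycle, C'.IsSubdivision C → ∀ f, ¬ C'.IsCopyIn D f}

/-! Everything is reduced to counting sinks. A cycle has at least as many blocks as sinks, and
subdividing creates no sinks, so a subdivision of `C` has at most `C.length` of them. Hence it
suffices to find acyclic digraphs of large chromatic number whose oriented cycles all have more than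
`b` sinks (`exists_acyclic_not_colorable_lt_ncard_sinks`).

They are built by induction on the number `c` of colours. Given `D` that is not `c`-colourable, take
a hypergraph with edges of size `|D|`, without cycles of at most `b` edges, such that every `(c +
1)`-colouring has a monochromatic edge. Attach a copy of `D` to each edge by a matching directed
towards the edge. The colour of a monochromatic edge is unavailable on its copy, so `c + 1` colours
do not suffice. A cycle of the digraph that is not inside one copy turns at hypergraph vertices, all
of them sinks; with at most `b` sinks it would trace a short cycle of the hypergraph
(`lt_ncard_sinks_matchHypergraph`).

The hypergraphs come from partite amalgamation in the manner of Nešetřil and Rödl, by induction on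
the length of the excluded cycles (`HypergraphSparse.glue`). -/

/-! ### Sparse hypergraphs of large chromatic number -/

section Hypergraphs

/-- A hypergraph with edges `φ e`, each parametrised by `ι`, is sparse up to `p` if in every set of
at most `p` edges, each edge of it has a companion that meets the union of the other edges in at
most one vertex. This excludes cycles of at most `p` edges. -/
def HypergraphSparse {V E ι : Type} (φ : E → ι → V) (p : ℕ) : Prop :=
  ∀ F : Finset E, F.card ≤ p → F.Nontrivial → ∀ e₀ ∈ F, ∃ e ∈ F, e ≠ e₀ ∧
    {v | v ∈ Set.range (φ e) ∧ ∃ e' ∈ F, e' ≠ e ∧ v ∈ Set.range (φ e')}.Subsingleton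

/-- This is what the freedom to avoid `e₀` is for: if the point of `K` lies on `e₀`, then for any
other edge it already counts as a vertex shared with `e₀`. -/
theorem HypergraphSparse.exists_rooted {V E ι : Type} {φ : E → ι → V} {p : ℕ}
    (h : HypergraphSparse φ p) (F : Finset E) (hF : F.card ≤ p) (hne : F.Nonempty)
    (K : Set V) (hK : K.Subsingleton) :
    ∃ e ∈ F, {v | v ∈ Set.range (φ e) ∧
      (v ∈ K ∨ ∃ e' ∈ F, e' ≠ e ∧ v ∈ Set.range (φ e'))}.Subsingleton := by
  rcases Set.subsingleton_or_nontrivial (F : Set E) with hs | hn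
  · obtain ⟨e, he⟩ := hne
    refine ⟨e, he, ?_⟩
    rintro v ⟨-, hv | ⟨e', he', hne, -⟩⟩ w ⟨-, hw | ⟨e'', he'', hne', -⟩⟩
    · exact hK hv hw
    · exact absurd (hs he'' he) hne'
    · exact absurd (hs he' he) hne
    · exact absurd (hs he' he) hne
  · by_cases hroot : ∃ e₀ ∈ F, ∃ v ∈ K, v ∈ Set.range (φ e₀)
    · obtain ⟨e₀, he₀, x, hx, hxe⟩ := hroot
      obtain ⟨e, he, hee, hs⟩ := h F hF hn e₀ he₀
      have key : ∀ v, v ∈ K → v = x := fun v hv => hK hv hx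
      refine ⟨e, he, hs.anti ?_⟩
      rintro v ⟨hv, hv' | hv'⟩
      · exact ⟨hv, e₀, he₀, hee.symm, by rw [key v hv']; exact hxe⟩
      · exact ⟨hv, hv'⟩
    · obtain ⟨e₀, he₀⟩ := hne
      obtain ⟨e, he, hee, hs⟩ := h F hF hn e₀ he₀
      refine ⟨e, he, hs.anti ?_⟩
      rintro v ⟨hv, hv' | hv'⟩
      · exact absurd ⟨e, he, v, hv', hv⟩ hroot
      · exact ⟨hv, hv'⟩

/-! ### Partite amalgamation -/

open Classical in
/-- The embedding of the copy with index `h` when copies of `V` are glued along the part of colour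
`t`, following the hypergraph `ψ`. -/
noncomputable def glueMap {V VH EH T : Type} (π : V → T) (t : T) (ψ : EH → {v // π v = t} → VH)
    (h : EH) (v : V) : VH ⊕ (V × EH) :=
  if hv : π v = t then Sum.inl (ψ h ⟨v, hv⟩) else Sum.inr (v, h)

section Glue

variable {V E ι VH EH T : Type} {π : V → T} {t : T} {ψ : EH → {v // π v = t} → VH}

theorem elim_glueMap (h : EH) (v : V) :
    Sum.elim (fun _ => t) (fun x => π x.1) (glueMap π t ψ h v) = π v := by
  unfold glueMap
  split_ifs with hv
  · simp [hv]
  · simp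

theorem glueMap_eq_glueMap (hψ : ∀ h, Function.Injective (ψ h)) {h : EH} {v w : V}
    (hvw : glueMap π t ψ h v = glueMap π t ψ h w) : v = w := by
  unfold glueMap at hvw
  split_ifs at hvw with h1 h2 h2
  · simpa using hψ h (Sum.inl.inj hvw)
  · simpa using hvw

theorem exists_of_glueMap_eq {h h' : EH} (hne : h ≠ h') {v w : V}
    (hvw : glueMap π t ψ h v = glueMap π t ψ h' w) :
    ∃ (hv : π v = t) (hw : π w = t), ψ h ⟨v, hv⟩ = ψ h' ⟨w, hw⟩ := by
  unfold glueMap at hvw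
  split_ifs at hvw with h1 h2 h2
  · exact ⟨h1, h2, Sum.inl.inj hvw⟩
  · simp only [Sum.inr.injEq, Prod.mk.injEq] at hvw
    exact absurd hvw.2 hne

/-- Count the copies that `F` uses. If there is one, `sφ` applies. If there are between two and `p`,
`sψ` gives a copy sharing at most one vertex with the others, and this vertex is the root for
`exists_rooted`. If there are `p + 1`, the edges lie in different copies, so they can share only
vertices of part `t`, and each edge has at most one of these. Thus `ψ` needs sparsity only up to
`p`. -/
theorem HypergraphSparse.glue {φ : E → ι → V} {p : ℕ} (hφ : ∀ e, Function.Injective (π ∘ φ e))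
    (hψ : ∀ h, Function.Injective (ψ h)) (sφ : HypergraphSparse φ (p + 1))
    (sψ : HypergraphSparse ψ p) :
    HypergraphSparse (fun (x : E × EH) i => glueMap π t ψ x.2 (φ x.1 i)) (p + 1) := by
  classical
  rintro F hF hn ⟨e₀, h₀⟩ he₀
  rcases Set.subsingleton_or_nontrivial ((F.image Prod.snd : Finset EH) : Set EH) with hs | hA
  · have snd_eq : ∀ x ∈ F, x.2 = h₀ := fun x hx =>
      hs (Finset.mem_coe.2 (Finset.mem_image_of_mem Prod.snd hx))
        (Finset.mem_coe.2 (Finset.mem_image_of_mem Prod.snd he₀))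
    have hn' : (F.image Prod.fst).Nontrivial := by
      obtain ⟨x, hx, y, hy, hxy⟩ := hn
      refine ⟨x.1, by simpa using ⟨x.2, hx⟩, y.1, by simpa using ⟨y.2, hy⟩, fun h => hxy ?_⟩
      exact Prod.ext h ((snd_eq x hx).trans (snd_eq y hy).symm)
    obtain ⟨e, he, hee, hs'⟩ := sφ (F.image Prod.fst) (Finset.card_image_le.trans hF) hn' e₀
      (Finset.mem_image_of_mem Prod.fst he₀)
    obtain ⟨⟨e1, h1⟩, hx, rfl⟩ := Finset.mem_image.1 he
    obtain rfl : h1 = h₀ := snd_eq _ hx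
    refine ⟨(e1, h1), hx, fun h => hee (congrArg Prod.fst h), ?_⟩
    have key : ∀ v, (v ∈ Set.range (fun i => glueMap π t ψ h1 (φ e1 i)) ∧ ∃ e' ∈ F, e' ≠ (e1, h1) ∧
        v ∈ Set.range (fun i => glueMap π t ψ e'.2 (φ e'.1 i))) → ∃ u, v = glueMap π t ψ h1 u ∧
        u ∈ Set.range (φ e1) ∧ ∃ e' ∈ F.image Prod.fst, e' ≠ e1 ∧ u ∈ Set.range (φ e') := by
      rintro _ ⟨⟨i, rfl⟩, ⟨e', h'⟩, he', hne, j, hj⟩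
      obtain rfl : h' = h1 := snd_eq _ he'
      refine ⟨_, rfl, ⟨i, rfl⟩, e', Finset.mem_image_of_mem Prod.fst he', ?_, j,
        glueMap_eq_glueMap hψ hj⟩
      rintro rfl
      exact hne rfl
    intro v hv w hw
    obtain ⟨v', rfl, hv'⟩ := key v hv
    obtain ⟨w', rfl, hw'⟩ := key w hw
    rw [hs' hv' hw']
  · by_cases hc : (F.image Prod.snd).card ≤ p
    · obtain ⟨h, hh, hne, hK⟩ := sψ _ hc hA h₀ (Finset.mem_image_of_mem Prod.snd he₀)
      obtain ⟨x, hx, hxh⟩ := Finset.mem_image.1 hh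
      obtain ⟨e, he, hs⟩ := sφ.exists_rooted ((F.filter (fun x => x.2 = h)).image Prod.fst)
        (Finset.card_image_le.trans ((Finset.card_filter_le _ _).trans hF))
        ⟨x.1, Finset.mem_image_of_mem Prod.fst (Finset.mem_filter.2 ⟨hx, hxh⟩)⟩
        {v | ∃ hv : π v = t, ∃ h' ∈ F.image Prod.snd, h' ≠ h ∧ ψ h ⟨v, hv⟩ ∈ Set.range (ψ h')} (by
          rintro v ⟨hv, h', hh', hn', hr⟩ w ⟨hw, h'', hh'', hn'', hr'⟩
          have := hK ⟨⟨_, rfl⟩, h', hh', hn', hr⟩ ⟨⟨_, rfl⟩, h'', hh'', hn'', hr'⟩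
          simpa using hψ h this)
      simp only [Finset.mem_image, Finset.mem_filter] at he
      obtain ⟨⟨e1, h1⟩, ⟨he1, rfl⟩, rfl⟩ := he
      refine ⟨(e1, h1), he1, fun h => hne (congrArg Prod.snd h), ?_⟩
      rintro _ ⟨⟨i, rfl⟩, hv⟩ _ ⟨⟨j, rfl⟩, hw⟩
      have key : ∀ i, (∃ e' ∈ F, e' ≠ (e1, h1) ∧ glueMap π t ψ h1 (φ e1 i) ∈
          Set.range (fun i => glueMap π t ψ e'.2 (φ e'.1 i))) →
          φ e1 i ∈ {v | v ∈ Set.range (φ e1) ∧ (v ∈ {v | ∃ hv : π v = t,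
            ∃ h' ∈ F.image Prod.snd, h' ≠ h1 ∧ ψ h1 ⟨v, hv⟩ ∈ Set.range (ψ h')} ∨
            ∃ e' ∈ (F.filter (fun x => x.2 = h1)).image Prod.fst, e' ≠ e1 ∧
              v ∈ Set.range (φ e'))} := by
        rintro i ⟨⟨e', h'⟩, he', hne', j, hj⟩
        refine ⟨⟨i, rfl⟩, ?_⟩
        by_cases hh' : h' = h1
        · subst hh'
          refine Or.inr ⟨e', Finset.mem_image.2 ⟨(e', h'), Finset.mem_filter.2 ⟨he', rfl⟩, rfl⟩,
            ?_, j, glueMap_eq_glueMap hψ hj⟩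
          rintro rfl
          exact hne' rfl
        · obtain ⟨hv, hw, hvw⟩ := exists_of_glueMap_eq hh' hj
          exact Or.inl ⟨hw, h', Finset.mem_image_of_mem Prod.snd he', hh', _, hvw⟩
      exact congrArg (glueMap π t ψ h1) (hs (key i hv) (key j hw))
    · have hcard : (F.image Prod.snd).card = F.card :=
        le_antisymm Finset.card_image_le (by omega)
      have hinj := Finset.card_image_iff.1 hcard
      obtain ⟨h, hh, hne⟩ := hA.exists_ne h₀
      obtain ⟨⟨e, h1⟩, hx, rfl⟩ := Finset.mem_image.1 (Finset.mem_coe.1 hh)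
      refine ⟨(e, h1), hx, fun h => hne (congrArg Prod.snd h), ?_⟩
      have key : ∀ i, (∃ e' ∈ F, e' ≠ (e, h1) ∧ glueMap π t ψ h1 (φ e i) ∈
          Set.range (fun i => glueMap π t ψ e'.2 (φ e'.1 i))) → π (φ e i) = t := by
        rintro i ⟨⟨e', h'⟩, he', hne', j, hj⟩
        exact (exists_of_glueMap_eq (fun hh => hne' (hinj he' hx hh)) hj).2.1
      rintro _ ⟨⟨i, rfl⟩, hv⟩ _ ⟨⟨j, rfl⟩, hw⟩
      rw [hφ e ((key i hv).trans (key j hw).symm)]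

end Glue

theorem exists_embedding_monochromatic {ι κ : Type} [Finite ι] [Finite κ] [Nonempty κ]
    (c : κ × ι → κ) : ∃ (b : ι ↪ κ × ι) (a : κ), ∀ i, c (b i) = a := by
  classical
  have := Fintype.ofFinite ι
  have := Fintype.ofFinite κ
  obtain ⟨a, ha⟩ := Fintype.exists_le_card_fiber_of_mul_le_card (n := Fintype.card ι) c (by simp)
  have : Fintype.card ι ≤ Fintype.card {x // c x = a} := by
    rwa [Fintype.card_subtype]
  obtain ⟨b⟩ := Function.Embedding.nonempty_of_card_le this
  exact ⟨b.trans (Function.Embedding.subtype _), a, fun i => (b i).2⟩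

/-- The partite amalgamation: the parts in `S` have been made monochromatic. -/
theorem exists_partite_hypergraph {κ ι T : Type} [Finite ι] [Finite κ] [Finite T] [Nonempty κ]
    {p : ℕ} (hp : ∀ (ι : Type) [Finite ι], ∃ (V E : Type) (_ : Finite V) (_ : Finite E)
      (φ : E → ι → V), (∀ e, Function.Injective (φ e)) ∧ HypergraphSparse φ p ∧
      ∀ col : V → κ, ∃ e a, ∀ i, col (φ e i) = a) (S : Finset T) :
    ∃ (V E : Type) (_ : Finite V) (_ : Finite E) (φ : E → ι → V) (π : V → T),
      (∀ e, Function.Injective (π ∘ φ e)) ∧ HypergraphSparse φ (p + 1) ∧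
      ∀ col : V → κ, ∃ (g : (ι ↪ T) → E) (c : T → κ), ∀ b i, π (φ (g b) i) = b i ∧
        (b i ∈ S → col (φ (g b) i) = c (b i)) := by
  classical
  induction S using Finset.induction_on with
  | empty =>
    refine ⟨(ι ↪ T) × ι, ι ↪ T, inferInstance, inferInstance, fun b i => (b, i),
      fun x => x.1 x.2, fun e => e.injective, ?_, fun col => ⟨id, fun _ => Classical.arbitrary κ,
        by simp⟩⟩
    intro F _ hn e₀ he₀
    obtain ⟨e, he, hne⟩ := Set.Nontrivial.exists_ne hn e₀
    refine ⟨e, he, hne, ?_⟩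
    rintro _ ⟨⟨i, rfl⟩, e', -, hne', j, hj⟩
    exact absurd (congrArg Prod.fst hj) hne'
  | insert t S ht ih =>
    obtain ⟨V, E, _, _, φ, π, hφ, sφ, cφ⟩ := ih
    obtain ⟨VH, EH, _, _, ψ, hψ, sψ, cψ⟩ := hp {v // π v = t}
    refine ⟨VH ⊕ (V × EH), E × EH, inferInstance, inferInstance,
      fun x i => glueMap π t ψ x.2 (φ x.1 i), Sum.elim (fun _ => t) (fun x => π x.1), ?_,
      sφ.glue hφ hψ sψ, ?_⟩
    · rintro ⟨e, h⟩ i j hij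
      simp only [Function.comp_apply, elim_glueMap] at hij
      exact hφ e hij
    · intro col
      -- In the copy `h`, part `t` is monochromatic; the colouring pulled back to this copy takes
      -- care of the parts in `S`.
      obtain ⟨h, a, ha⟩ := cψ (fun x => col (Sum.inl x))
      obtain ⟨g, c, hg⟩ := cφ (fun v => col (glueMap π t ψ h v))
      refine ⟨fun b => (g b, h), Function.update c t a, fun b i => ⟨?_, fun hb => ?_⟩⟩
      · simp only [elim_glueMap, (hg b i).1]
      · by_cases hbt : b i = t
        · rw [hbt, Function.update_self]
          have hv : π (φ (g b) i) = t := (hg b i).1.trans hbt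
          simp only [glueMap, hv, dite_true, ha]
        · rw [Function.update_of_ne hbt]
          exact (hg b i).2 ((Finset.mem_insert.1 hb).resolve_left hbt)

/-- There are uniform hypergraphs without short cycles that need many colours. -/
theorem exists_sparse_hypergraph (κ : Type) [Finite κ] [Nonempty κ] (p : ℕ) :
    ∀ (ι : Type) [Finite ι], ∃ (V E : Type) (_ : Finite V) (_ : Finite E)
      (φ : E → ι → V), (∀ e, Function.Injective (φ e)) ∧ HypergraphSparse φ p ∧
      ∀ col : V → κ, ∃ e a, ∀ i, col (φ e i) = a := by
  induction p with
  | zero =>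
    intro ι _
    refine ⟨κ × ι, ι ↪ κ × ι, inferInstance, inferInstance, fun b i => b i, fun b => b.injective,
      ?_, exists_embedding_monochromatic⟩
    intro F hF hn
    have := Finset.card_pos.2 hn.nonempty
    omega
  | succ p hp =>
    intro ι _
    have := Fintype.ofFinite κ
    have := Fintype.ofFinite ι
    -- Once all parts are monochromatic, `κ × ι` is large enough for the pigeonhole principle to
    -- give `|ι|` parts of the same colour.
    obtain ⟨V, E, hV, hE, φ, π, hφ, sφ, cφ⟩ :=
      exists_partite_hypergraph (ι := ι) hp (Finset.univ : Finset (κ × ι))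
    refine ⟨V, E, hV, hE, φ, fun e => (hφ e).of_comp, sφ, fun col => ?_⟩
    obtain ⟨g, c, hg⟩ := cφ col
    obtain ⟨b, a, hb⟩ := exists_embedding_monochromatic c
    exact ⟨g b, a, fun i => ((hg b i).2 (Finset.mem_univ _)).trans (hb i)⟩

end Hypergraphs

/-! ### Sinks, blocks and subdivisions -/

namespace OrientedCycle

instance (C : OrientedCycle) : NeZero C.length := ⟨by have := C.two_le; omega⟩

instance (C : OrientedCycle) : Nontrivial (ZMod C.length) :=
  (ZMod.nontrivial_iff).2 (by have := C.two_le; omega)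

/-- The sinks of an oriented cycle. -/
def sinks (C : OrientedCycle) : Set (ZMod C.length) :=
  {i | C.fwd (i - 1) = true ∧ C.fwd i = false}

theorem forall_of_closed_succ (C : OrientedCycle) {P : ZMod C.length → Prop}
    {i : ZMod C.length} (hi : P i) (hP : ∀ j, P j → P (j + 1)) (j : ZMod C.length) : P j := by
  have key : ∀ m : ℕ, P (i + m) := by
    intro m
    induction m with
    | zero => simpa using hi
    | succ m ih => simpa [add_assoc] using hP _ ih
  simpa using key (j - i).val

/-- The backward run starting at `i` stops at the latest at the forward arc `i - 1 = i + (length -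
1)`. -/
theorem exists_isBlock (C : OrientedCycle) {i : ZMod C.length} (hi : i ∈ C.sinks) :
    ∃ l, C.IsBlock i l := by
  classical
  obtain ⟨h1, h2⟩ := hi
  have hex : ∃ l : ℕ, C.fwd (i + l) ≠ C.fwd i := by
    refine ⟨C.length - 1, ?_⟩
    have : ((C.length - 1 : ℕ) : ZMod C.length) = -1 := by
      rw [Nat.cast_sub (by have := C.two_le; omega)]
      simp
    rw [this, ← sub_eq_add_neg, h1, h2]
    simp
  refine ⟨Nat.find hex, ?_, ?_, fun t ht => ?_, by simp [h1, h2], Nat.find_spec hex⟩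
  · rw [Nat.one_le_iff_ne_zero]
    intro h0
    have := Nat.find_spec hex
    rw [h0] at this
    simp at this
  · have hle : Nat.find hex ≤ C.length - 1 := by
      refine Nat.find_min' hex ?_
      have : ((C.length - 1 : ℕ) : ZMod C.length) = -1 := by
        rw [Nat.cast_sub (by have := C.two_le; omega)]
        simp
      rw [this, ← sub_eq_add_neg, h1, h2]
      simp
    have := C.two_le
    omega
  · simpa using Nat.find_min hex ht

theorem ncard_sinks_le_numBlocks (C : OrientedCycle) : C.sinks.ncard ≤ C.numBlocks := by
  rcases Set.eq_empty_or_nonempty C.sinks with h0 | ⟨i, hi⟩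
  · simp [h0]
  · have hd : ¬ C.IsDirected := fun h => by
      have := h (i - 1) i
      rw [hi.1, hi.2] at this
      simp at this
    rw [numBlocks, if_neg hd]
    have hfin : {p : ZMod C.length × ℕ | C.IsBlock p.1 p.2}.Finite :=
      (Set.finite_univ.prod (Set.finite_lt_nat C.length)).subset fun p hp => ⟨trivial, hp.2.1⟩
    refine (Set.ncard_le_ncard ?_ (hfin.image Prod.fst)).trans (Set.ncard_image_le hfin)
    intro j hj
    obtain ⟨l, hl⟩ := C.exists_isBlock hj
    exact ⟨(j, l), hl, rfl⟩

/-- At an inner vertex of a subdivided arc both arcs have the same direction, so sinks occur only at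
the vertices `p i`. -/
theorem IsSubdivision.ncard_sinks_le {C' C : OrientedCycle} (h : C'.IsSubdivision C) :
    C'.sinks.ncard ≤ C.length := by
  obtain ⟨p, hp, hper, hfwd⟩ := h
  have hsub : C'.sinks ⊆ (fun i : ℕ => (p i : ZMod C'.length)) '' (Finset.range C.length) := by
    rintro t ⟨ht1, ht2⟩
    obtain ⟨j, hj0, hj1, rfl⟩ : ∃ j : ℕ, p 0 ≤ j ∧ j < p C.length ∧ (j : ZMod C'.length) = t := by
      refine ⟨p 0 + (t - p 0).val, by omega, ?_, by simp⟩
      have := hper 0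
      have := ZMod.val_lt (t - (p 0 : ZMod C'.length))
      simp_all
    have hex : ∃ i, j < p (i + 1) := ⟨j, (hp.id_le (j + 1))⟩
    classical
    set i := Nat.find hex with hi
    have hi1 : j < p (i + 1) := Nat.find_spec hex
    have hi0 : p i ≤ j := by
      rcases Nat.eq_zero_or_pos i with h0 | hpos
      · rwa [h0]
      · have := Nat.find_min hex (show i - 1 < Nat.find hex by omega)
        rw [Nat.sub_add_cancel hpos] at this
        omega
    have hil : i < C.length := hp.lt_iff_lt.1 (hi0.trans_lt hj1)
    refine ⟨i, by simpa using hil, ?_⟩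
    rcases hi0.eq_or_lt with heq | hlt
    · simp [heq]
    · have e1 := hfwd i j hi0 hi1
      have e2 := hfwd i (j - 1) (by omega) (by omega)
      rw [Nat.cast_sub (by omega), Nat.cast_one, ht1] at e2
      rw [ht2, ← e2] at e1
      simp at e1
  calc C'.sinks.ncard ≤ _ := Set.ncard_le_ncard hsub ((Finset.finite_toSet _).image _)
    _ ≤ _ := Set.ncard_image_le (Finset.finite_toSet _)
    _ = _ := by simp

theorem adj_or_adj (C : OrientedCycle) {D : FinDigraph} {f : ZMod C.length → D.V}
    (hf : C.IsCopyIn D f) (i : ZMod C.length) :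
    (C.fwd i = true ∧ D.graph.Adj (f i) (f (i + 1))) ∨
      (C.fwd i = false ∧ D.graph.Adj (f (i + 1)) (f i)) := by
  have := hf.2.1 i
  unfold tail head at this
  cases h : C.fwd i <;> simp_all

end OrientedCycle

/-! ### Matching copies of a digraph with hypergraph edges -/

namespace FinDigraph

/-- Adjacency in the digraph that consists of a copy of `D` for every edge of the hypergraph `φ`,
the vertices of the hypergraph, and arcs that match the copies with the edges. -/
inductive MatchAdj (D : FinDigraph) {V E : Type} (φ : E → D.V → V) :
    V ⊕ (D.V × E) → V ⊕ (D.V × E) → Prop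
  | inner {u v : D.V} (h : E) : D.graph.Adj u v → MatchAdj D φ (Sum.inr (u, h)) (Sum.inr (v, h))
  | outer (u : D.V) (h : E) : MatchAdj D φ (Sum.inr (u, h)) (Sum.inl (φ h u))

/-- Copies of `D`, one for every edge of the hypergraph `φ`, matched with the edges. -/
def matchHypergraph (D : FinDigraph) {V E : Type} [Finite V] [Finite E] (φ : E → D.V → V) :
    FinDigraph where
  V := V ⊕ (D.V × E)
  finite := by have := D.finite; infer_instance
  graph := ⟨MatchAdj D φ⟩
  loopless := by
    rintro _ (⟨h, hv⟩ | _)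
    exact D.loopless _ hv

section Match

variable {D : FinDigraph} {V E : Type} [Finite V] [Finite E] {φ : E → D.V → V}

theorem adj_inr_iff {x : V ⊕ (D.V × E)} {v : D.V} {h : E} :
    (D.matchHypergraph φ).graph.Adj x (Sum.inr (v, h)) ↔
      ∃ u, x = Sum.inr (u, h) ∧ D.graph.Adj u v := by
  constructor
  · intro hx
    cases hx with
    | inner _ hu => exact ⟨_, rfl, hu⟩
  · rintro ⟨u, rfl, hu⟩
    exact .inner h hu

theorem adj_inl_iff {x : V ⊕ (D.V × E)} {v : V} :
    (D.matchHypergraph φ).graph.Adj x (Sum.inl v) ↔ ∃ u h, x = Sum.inr (u, h) ∧ φ h u = v := by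
  constructor
  · intro hx
    cases hx with
    | outer u h => exact ⟨u, h, rfl, rfl⟩
  · rintro ⟨u, h, rfl, rfl⟩
    exact .outer u h

theorem not_inl_adj {x : V} {y : V ⊕ (D.V × E)} :
    ¬ (D.matchHypergraph φ).graph.Adj (Sum.inl x) y := by
  rintro ⟨⟩

/-- No arc leaves a hypergraph vertex, so a closed directed walk stays in one copy. -/
theorem Acyclic.matchHypergraph (hD : D.Acyclic) : (D.matchHypergraph φ).Acyclic := by
  have key : ∀ x y, Relation.TransGen (D.matchHypergraph φ).graph.Adj x y → ∀ v h,
      y = Sum.inr (v, h) → ∃ u, x = Sum.inr (u, h) ∧ Relation.TransGen D.graph.Adj u v := by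
    intro x y hxy
    induction hxy with
    | single hx =>
      rintro v h rfl
      obtain ⟨u, rfl, hu⟩ := adj_inr_iff.1 hx
      exact ⟨u, rfl, .single hu⟩
    | tail _ hx ih =>
      rintro v h rfl
      obtain ⟨u, rfl, hu⟩ := adj_inr_iff.1 hx
      obtain ⟨w, rfl, hw⟩ := ih u h rfl
      exact ⟨w, rfl, hw.tail hu⟩
  rintro (v | ⟨v, h⟩) hv
  · obtain ⟨y, hy, -⟩ := Relation.TransGen.head'_iff.1 hv
    exact not_inl_adj hy
  · obtain ⟨u, hu, huv⟩ := key _ _ hv v h rfl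
    obtain ⟨rfl, -⟩ := Prod.mk.inj (Sum.inr.inj hu)
    exact hD _ huv

theorem not_colorable_matchHypergraph {c : ℕ}
    (hD : ¬ D.graph.toSimpleGraphInclusive.Colorable c)
    (hφ : ∀ col : V → Fin (c + 1), ∃ e a, ∀ i, col (φ e i) = a) :
    ¬ (D.matchHypergraph φ).graph.toSimpleGraphInclusive.Colorable (c + 1) := by
  rintro ⟨col⟩
  obtain ⟨h, a, ha⟩ := hφ (fun v => col (Sum.inl v))
  refine hD ?_
  have hne : ∀ u, col (Sum.inr (u, h)) ≠ a := by
    intro u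
    rw [← ha u]
    exact col.valid ⟨Sum.inr_ne_inl, Or.inl (MatchAdj.outer u h)⟩
  have col' : D.graph.toSimpleGraphInclusive.Coloring {x : Fin (c + 1) // x ≠ a} :=
    SimpleGraph.Coloring.mk (fun u => ⟨col (Sum.inr (u, h)), hne u⟩) (by
      intro u v huv heq
      refine col.valid (v := Sum.inr (u, h)) (w := Sum.inr (v, h)) ?_ (congrArg Subtype.val heq)
      simp only [Digraph.toSimpleGraphInclusive, SimpleGraph.fromRel_adj] at huv ⊢
      refine ⟨fun h => huv.1 (congrArg Prod.fst (Sum.inr.inj h)), ?_⟩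
      exact huv.2.imp (MatchAdj.inner h) (MatchAdj.inner h))
  simpa using col'.colorable

open OrientedCycle

theorem isCopyIn_matchHypergraph_at_inl {C : OrientedCycle}
    {f : ZMod C.length → V ⊕ (D.V × E)} (hφ : ∀ e, Function.Injective (φ e))
    (hf : C.IsCopyIn (D.matchHypergraph φ) f) {i : ZMod C.length} {x : V}
    (hi : f i = Sum.inl x) :
    i ∈ C.sinks ∧ ∃ u h u' h', f (i - 1) = Sum.inr (u, h) ∧ f (i + 1) = Sum.inr (u', h') ∧
      φ h u = x ∧ φ h' u' = x ∧ h ≠ h' := by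
  have a1 := C.adj_or_adj hf (i - 1)
  have a2 := C.adj_or_adj hf i
  rw [sub_add_cancel] at a1
  simp only [hi, not_inl_adj, and_false, or_false, false_or, adj_inl_iff] at a1 a2
  obtain ⟨s1, u, h, e1, p1⟩ := a1
  obtain ⟨s2, u', h', e2, p2⟩ := a2
  refine ⟨⟨s1, s2⟩, u, h, u', h', e1, e2, p1, p2, ?_⟩
  -- Within one copy, both arcs into `x` would be the same arc. Injectivity on arcs is needed here
  -- because `i - 1 = i + 1` in length `2`.
  rintro rfl
  obtain rfl := hφ h (p1.trans p2.symm)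
  have : i - 1 = i := hf.2.2 (by simp [tail, head, s1, s2, e1, e2])
  simp at this

theorem lt_ncard_sinks_matchHypergraph {b : ℕ} (hφ : ∀ e, Function.Injective (φ e))
    (sφ : HypergraphSparse φ b)
    (hD : ∀ (C : OrientedCycle) f, C.IsCopyIn D f → b < C.sinks.ncard)
    (C : OrientedCycle) (f : ZMod C.length → V ⊕ (D.V × E))
    (hf : C.IsCopyIn (D.matchHypergraph φ) f) : b < C.sinks.ncard := by
  classical
  by_cases hX : ∃ i x, f i = Sum.inl x
  swap
  · push Not at hX
    obtain ⟨u₀, h, h0⟩ : ∃ u h, f 0 = Sum.inr (u, h) := by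
      rcases hf0 : f 0 with x | ⟨u, h⟩
      · exact absurd hf0 (hX 0 x)
      · exact ⟨u, h, rfl⟩
    have hall : ∀ j, ∃ u, f j = Sum.inr (u, h) := by
      refine C.forall_of_closed_succ (P := fun j => ∃ u, f j = Sum.inr (u, h)) ⟨u₀, h0⟩ ?_
      rintro j ⟨u, hu⟩
      rcases hj : f (j + 1) with x | ⟨v, h'⟩
      · exact absurd hj (hX _ x)
      · have := C.adj_or_adj hf j
        rw [hu, hj] at this
        simp only [adj_inr_iff] at this
        rcases this with ⟨-, w, hw, -⟩ | ⟨-, w, hw, -⟩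
        · exact ⟨v, by rw [(Prod.mk.inj (Sum.inr.inj hw)).2]⟩
        · exact ⟨v, by rw [(Prod.mk.inj (Sum.inr.inj hw)).2]⟩
    choose g hg using hall
    refine hD C g ⟨fun i j hij => hf.1 (by rw [hg, hg, hij]), fun i => ?_, fun i j hij => ?_⟩
    · have := hf.2.1 i
      rw [hg, hg, adj_inr_iff] at this
      obtain ⟨u, hu, huv⟩ := this
      rwa [(Prod.mk.inj (Sum.inr.inj hu)).1]
    · obtain ⟨e1, e2⟩ := Prod.mk.inj hij
      exact hf.2.2 (by simp only [hg, e1, e2])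
  · obtain ⟨i₀, x₀, hx₀⟩ := hX
    by_contra! hb
    have := Fintype.ofFinite E
    set P : E → ZMod C.length → Prop := fun h j => ∃ u, f j = Sum.inr (u, h) with hP
    have P_unique : ∀ {h h' j}, P h j → P h' j → h = h' := by
      rintro h h' j ⟨u, hu⟩ ⟨u', hu'⟩
      exact (Prod.mk.inj (Sum.inr.inj (hu.symm.trans hu'))).2
    have P_not : ∀ h, ¬ P h i₀ := by
      rintro h ⟨u, hu⟩
      rw [hx₀] at hu
      cases hu
    set A : Finset E := Finset.univ.filter (fun h => ∃ j, P h j) with hA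
    have mem_A : ∀ {h j}, P h j → h ∈ A := fun {h j} hj => by
      simp only [hA, Finset.mem_filter, Finset.mem_univ, true_and]
      exact ⟨j, hj⟩
    -- leaving a copy of `D` leads to a vertex of the hypergraph
    have leave : ∀ h ∈ A, ∃ j, P h j ∧ ∃ u, f (j + 1) = Sum.inl (φ h u) := by
      intro h hh
      obtain ⟨k, hk⟩ := (Finset.mem_filter.1 hh).2
      obtain ⟨j, hj, hj'⟩ : ∃ j, P h j ∧ ¬ P h (j + 1) := by
        by_contra! hcon
        exact P_not h (C.forall_of_closed_succ hk hcon i₀)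
      refine ⟨j, hj, ?_⟩
      obtain ⟨u, hu⟩ := hj
      have ha := C.adj_or_adj hf j
      rcases hf1 : f (j + 1) with x | ⟨v, h'⟩
      · rw [hu, hf1] at ha
        simp only [not_inl_adj, and_false, or_false, adj_inl_iff] at ha
        obtain ⟨-, u', h', e, rfl⟩ := ha
        obtain ⟨rfl, rfl⟩ := Prod.mk.inj (Sum.inr.inj e)
        exact ⟨_, rfl⟩
      · refine absurd ⟨v, ?_⟩ hj'
        rw [hu, hf1] at ha
        simp only [adj_inr_iff] at ha
        rcases ha with ⟨-, w, hw, -⟩ | ⟨-, w, hw, -⟩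
        · rw [hf1, (Prod.mk.inj (Sum.inr.inj hw)).2]
        · rw [hf1, (Prod.mk.inj (Sum.inr.inj hw)).2]
    have enter : ∀ h ∈ A, ∃ j, P h (j + 1) ∧ ∃ u, f j = Sum.inl (φ h u) := by
      intro h hh
      obtain ⟨k, hk⟩ := (Finset.mem_filter.1 hh).2
      obtain ⟨j, hj, hj'⟩ : ∃ j, ¬ P h j ∧ P h (j + 1) := by
        by_contra! hcon
        exact C.forall_of_closed_succ (P := fun j => ¬ P h j) (P_not h) hcon k hk
      refine ⟨j, hj', ?_⟩
      obtain ⟨u, hu⟩ := hj'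
      have ha := C.adj_or_adj hf j
      rcases hf1 : f j with x | ⟨v, h'⟩
      · rw [hu, hf1] at ha
        simp only [not_inl_adj, and_false, false_or, adj_inl_iff] at ha
        obtain ⟨-, u', h', e, rfl⟩ := ha
        obtain ⟨rfl, rfl⟩ := Prod.mk.inj (Sum.inr.inj e)
        exact ⟨_, rfl⟩
      · refine absurd ⟨v, ?_⟩ hj
        rw [hu, hf1] at ha
        simp only [adj_inr_iff] at ha
        rcases ha with ⟨-, w, hw, -⟩ | ⟨-, w, hw, -⟩
        · rw [hf1, (Prod.mk.inj (Sum.inr.inj hw)).2]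
        · rw [hf1, (Prod.mk.inj (Sum.inr.inj hw)).2]
    have card_A : A.card ≤ b := by
      refine le_trans ?_ hb
      choose! j hj hj' using leave
      rw [← Set.ncard_coe_finset A]
      -- Each visited copy is charged to the sink through which the cycle leaves it.
      refine Set.ncard_le_ncard_of_injOn (fun h => j h + 1) (fun h hh => ?_) ?_
      · obtain ⟨u, hu⟩ := hj' h hh
        exact (isCopyIn_matchHypergraph_at_inl hφ hf hu).1
      · intro h hh h' hh' heq
        have e : j h = j h' := add_right_cancel heq
        exact P_unique (hj h hh) (e ▸ hj h' hh')
    obtain ⟨-, u, h, u', h', e1, e2, -, -, hne⟩ := isCopyIn_matchHypergraph_at_inl hφ hf hx₀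
    have hh : h ∈ A := mem_A ⟨u, e1⟩
    obtain ⟨k, hk, hkh, hsub⟩ := sφ A card_A ⟨h, hh, h', mem_A ⟨u', e2⟩, hne⟩ h hh
    obtain ⟨j, hj, v, hv⟩ := leave k hk
    obtain ⟨l, hl, w, hw⟩ := enter k hk
    obtain ⟨-, r, m, r', m', g1, g2, q1, q2, hm⟩ := isCopyIn_matchHypergraph_at_inl hφ hf hv
    obtain ⟨-, s, n, s', n', t1, t2, z1, z2, hn⟩ := isCopyIn_matchHypergraph_at_inl hφ hf hw
    rw [add_sub_cancel_right] at g1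
    obtain rfl : m = k := P_unique ⟨r, g1⟩ hj
    obtain rfl : n' = m := P_unique ⟨s', t2⟩ hl
    have hvw : φ n' v = φ n' w := hsub
      ⟨⟨v, rfl⟩, m', mem_A ⟨r', g2⟩, hm.symm, r', q2⟩
      ⟨⟨w, rfl⟩, n, mem_A ⟨s, t1⟩, hn, s, z1⟩
    -- The exit from the copy and the entrance to it coincide, but the two neighbours of a
    -- hypergraph vertex on the cycle lie in different copies.
    have hjl : j + 1 = l := hf.1 (by rw [hv, hw, hvw])
    rw [hjl] at g2
    exact hm (P_unique hl ⟨r', g2⟩)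

end Match

/-- There are acyclic digraphs that need many colours in which every oriented cycle has many
sinks. -/
theorem exists_acyclic_not_colorable_lt_ncard_sinks (b c : ℕ) :
    ∃ D : FinDigraph, D.Acyclic ∧ ¬ D.graph.toSimpleGraphInclusive.Colorable c ∧
      ∀ (C : OrientedCycle) (f : ZMod C.length → D.V), C.IsCopyIn D f → b < C.sinks.ncard := by
  induction c with
  | zero =>
    refine ⟨⟨Unit, inferInstance, ⟨fun _ _ => False⟩, fun _ h => h⟩, ?_, ?_, ?_⟩
    · intro v hv
      obtain ⟨y, hy, -⟩ := Relation.TransGen.head'_iff.1 hv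
      exact hy
    · rintro ⟨col⟩
      exact (col ()).elim0
    · intro C f hf
      exact (hf.2.1 0).elim
  | succ c ih =>
    obtain ⟨D, hD, hc, hb⟩ := ih
    have := D.finite
    obtain ⟨V, E, _, _, φ, hφ, sφ, cφ⟩ := exists_sparse_hypergraph (Fin (c + 1)) b D.V
    exact ⟨D.matchHypergraph φ, hD.matchHypergraph, not_colorable_matchHypergraph hc cφ,
      lt_ncard_sinks_matchHypergraph hφ sφ hb⟩

theorem lt_chromaticNumber_of_not_colorable {D : FinDigraph} {c : ℕ}
    (h : ¬ D.graph.toSimpleGraphInclusive.Colorable c) : (c : ℕ∞) < D.chromaticNumber := by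
  rw [← not_le]
  exact fun hle => h (SimpleGraph.chromaticNumber_le_iff_colorable.1 hle)

end FinDigraph

/-! ### Conclusion -/

theorem classChromaticNumber_SForb_eq_top {𝒞 : Set OrientedCycle} (h𝒞 : 𝒞.Finite) :
    classChromaticNumber (SForb 𝒞) = ⊤ := by
  -- A common bound on the lengths bounds the sinks of all subdivisions at once.
  obtain ⟨b, hb⟩ := (h𝒞.image OrientedCycle.length).bddAbove
  refine sInf_eq_top.2 fun k hk => ?_
  by_contra hne
  lift k to ℕ using hne
  obtain ⟨D, -, hc, hD⟩ := FinDigraph.exists_acyclic_not_colorable_lt_ncard_sinks b k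
  refine (FinDigraph.lt_chromaticNumber_of_not_colorable hc).not_ge (hk D ?_)
  intro C hC C' hsub f hf
  exact ((hD C' f hf).trans_le hsub.ncard_sinks_le).not_ge (hb ⟨C, hC, rfl⟩)

theorem mainTheorem1 :
    (∀ b c : ℕ, 0 < b → 0 < c → ∃ D : FinDigraph, D.Acyclic ∧ (c : ℕ∞) ≤ D.chromaticNumber ∧
      ∀ (C : OrientedCycle) (f : ZMod C.length → D.V), C.IsCopyIn D f → b < C.numBlocks) ∧
    (∀ C : OrientedCycle, classChromaticNumber (SForb {C}) = ⊤) ∧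
    (∀ 𝒞 : Set OrientedCycle, 𝒞.Finite → classChromaticNumber (SForb 𝒞) = ⊤) := by
  refine ⟨fun b c _ _ => ?_, fun C => classChromaticNumber_SForb_eq_top (Set.finite_singleton C),
    fun 𝒞 => classChromaticNumber_SForb_eq_top⟩
  obtain ⟨D, hD, hc, hb⟩ := FinDigraph.exists_acyclic_not_colorable_lt_ncard_sinks b c
  exact ⟨D, hD, (FinDigraph.lt_chromaticNumber_of_not_colorable hc).le, fun C f hf =>
    (hb C f hf).trans_le C.ncard_sinks_le_numBlocks⟩
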